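/- All graphs are finite and simple. The core index $F(G)$ of a graph $G$ is the number of its connected subgraphs (non-empty, not necessarily induced, and counted as subgraphs of $G$, not up to isomorphism). A graph on $n$ vertices is unicyclic if it is connected and has exactly $n$ edges. For $3\le g<n$, the pineapple graph $U^p_{n,g}$ is the unicyclic graph on $n$ vertices obtained from the cycle $C_g$ by attaching $n-g$ pendant vertices to one vertex of the cycle. Let $n\ge 4$. Among all unicyclic graphs on $n$ vertices, the pineapple graph $U^p_{n,3}$ has the maximum core index, and it is, up to isomorphism, the only one that attains it; moreover $F(U^p_{n,3})=7\cdot 2^{n-3}+n$. That is, every unicyclic graph $G$ on $n$ vertices satisfies $$F(G)\le F(U^p_{n,3})=7\cdot 2^{n-3}+n,$$ with equality if and only if $G\cong U^p_{n,3}$. -/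

import Mathlib

/-- The core index `F(G)` of a finite graph `G`: the number of connected subgraphs of `G`.
A subgraph is a set of vertices together with a set of edges of `G` between them, not necessarily
induced; a connected subgraph has at least one vertex. -/
noncomputable def coreIndex {V : Type*} (G : SimpleGraph V) : ℕ :=
  Nat.card {H : G.Subgraph // H.Connected}

/-- A finite graph is unicyclic if it is connected and has as many edges as vertices. -/
def IsUnicyclic {V : Type*} [Fintype V] (G : SimpleGraph V) : Prop :=
  G.Connected ∧ G.edgeSet.ncard = Fintype.card V

/-- The pineapple graph `U^p_{n,g}`, for `3 ≤ g < n`, on the vertices `0, …, n - 1`: the cycle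
`0, 1, …, g - 1, 0` together with the `n - g` pendant vertices `g, …, n - 1`, all of them
attached to the vertex `0` of the cycle. -/
def pineapple (n g : ℕ) : SimpleGraph (Fin n) :=
  SimpleGraph.fromRel fun i j =>
    (i.val + 1 = j.val ∧ j.val < g) ∨
    (i.val = 0 ∧ j.val + 1 = g) ∨
    (i.val = 0 ∧ g ≤ j.val)

/-! Let `F(G; r)` count the connected subgraphs containing `r`. If `v` is a leaf with neighbour `w`,
a connected subgraph avoids `v`, or contains the edge `vw`, or is `v` alone, so `F(G) ≤ F(G - v) +
F(G - v; w) + 1`. With the rooted bound `F(G; r) ≤ 7 * 2 ^ (n - 3)`, the bound on `F(G)` follows by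
induction, and equality forces equality in the rooted bound for `w`.

The rooted bound is itself an induction on leaves: adding a leaf at `r` at most doubles the count,
adding it elsewhere gives strictly less than double, so equality makes `r` adjacent to every other
vertex. Both inductions end at 2-regular graphs, where counting admissible edge sets gives about `6
* 2 ^ (n - 3)`, strictly below the bound once `n ≥ 4`.

A unicyclic graph with a vertex adjacent to all others is a star plus one edge, that is, the
pineapple. An explicit family of connected subgraphs shows that it attains the bound
(`IsPineapple.le_coreIndex`). -/

namespace SimpleGraph

/-! ### Connectedness via cuts, and deletion of a leaf from a subgraph -/

variable {V : Type*} {G : SimpleGraph V}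

theorem Connected.exists_adj_of_mem_of_notMem {W : Type*} {K : SimpleGraph W} (hK : K.Connected)
    {S : Set W} {a b : W} (ha : a ∈ S) (hb : b ∉ S) : ∃ x y, K.Adj x y ∧ x ∈ S ∧ y ∉ S := by
  obtain ⟨p⟩ := hK.preconnected a b
  obtain ⟨d, -, h1, h2⟩ := p.exists_boundary_dart S ha hb
  exact ⟨d.fst, d.snd, d.adj, h1, h2⟩

theorem connected_of_exists_adj {W : Type*} [Nonempty W] {K : SimpleGraph W}
    (h : ∀ (S : Set W) (a b : W), a ∈ S → b ∉ S → ∃ x y, K.Adj x y ∧ x ∈ S ∧ y ∉ S) :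
    K.Connected := by
  refine ⟨fun a b => ?_⟩
  by_contra hab
  obtain ⟨x, y, hxy, hx, hy⟩ := h {x | K.Reachable a x} a b (Reachable.refl a) hab
  exact hy (Reachable.trans hx hxy.reachable)

namespace Subgraph

theorem Connected.exists_adj_of_mem_of_notMem {H : G.Subgraph} (hH : H.Connected) {S : Set V}
    {a b : V} (ha : a ∈ H.verts) (haS : a ∈ S) (hb : b ∈ H.verts) (hbS : b ∉ S) :
    ∃ x y, H.Adj x y ∧ x ∈ S ∧ y ∉ S := by
  obtain ⟨x, y, hxy, hx, hy⟩ := SimpleGraph.Connected.exists_adj_of_mem_of_notMem hH.coe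
    (S := {x | (x : V) ∈ S}) (a := ⟨a, ha⟩) (b := ⟨b, hb⟩) haS hbS
  exact ⟨x, y, hxy, hx, hy⟩

theorem connected_of_exists_adj {H : G.Subgraph} (hne : H.verts.Nonempty)
    (h : ∀ (S : Set V) (a b : V), a ∈ H.verts → a ∈ S → b ∈ H.verts → b ∉ S →
      ∃ x y, H.Adj x y ∧ x ∈ S ∧ y ∉ S) : H.Connected := by
  refine ⟨?_⟩
  have := hne.to_subtype
  refine SimpleGraph.connected_of_exists_adj fun S a b ha hb => ?_
  obtain ⟨x, y, hxy, ⟨x', hx', rfl⟩, hy⟩ := h (Subtype.val '' S) a b a.2 ⟨a, ha, rfl⟩ b.2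
    (by rintro ⟨c, hc, hcb⟩; exact hb (Subtype.ext hcb ▸ hc))
  exact ⟨x', ⟨y, H.edge_vert hxy.symm⟩, hxy, hx', fun hy' => hy ⟨_, hy', rfl⟩⟩

theorem Connected.exists_adj {H : G.Subgraph} (hH : H.Connected) {a b : V} (ha : a ∈ H.verts)
    (hb : b ∈ H.verts) (hab : b ≠ a) : ∃ y, H.Adj a y := by
  obtain ⟨x, y, hxy, rfl, -⟩ := hH.exists_adj_of_mem_of_notMem (S := {a}) ha rfl hb hab
  exact ⟨y, hxy⟩

/-- The subgraph of `G.induce {v}ᶜ` obtained from a subgraph of `G` by deleting the vertex `v`. -/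
def deleteVert (v : V) (H : G.Subgraph) : (G.induce {v}ᶜ).Subgraph :=
  H.comap (Embedding.induce {v}ᶜ).toHom

@[simp] theorem deleteVert_adj {v : V} {H : G.Subgraph} {x y : ({v}ᶜ : Set V)} :
    (H.deleteVert v).Adj x y ↔ H.Adj x y :=
  ⟨fun h => h.2, fun h => ⟨H.adj_sub h, h⟩⟩

variable {v w : V}

theorem Connected.deleteVert_of_leaf (hv : ∀ x, G.Adj v x → x = w) {H : G.Subgraph}
    (hH : H.Connected) {c : V} (hc : c ∈ H.verts) (hcv : c ≠ v) : (H.deleteVert v).Connected := by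
  refine connected_of_exists_adj ⟨⟨c, hcv⟩, hc⟩ fun S a b ha haS hb hbS => ?_
  -- The cut is extended to `v` by placing `v` on the side of `w`, so the edge `vw` never crosses
  -- it.
  obtain ⟨x, y, hxy, hx, hy⟩ := hH.exists_adj_of_mem_of_notMem
    (S := {x | (∃ h : x ≠ v, (⟨x, h⟩ : ({v}ᶜ : Set V)) ∈ S) ∨
      (x = v ∧ ∃ h : w ≠ v, (⟨w, h⟩ : ({v}ᶜ : Set V)) ∈ S)})
    ha (Or.inl ⟨a.2, haS⟩) hb (by
      rintro (⟨_, h⟩ | ⟨h, -⟩)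
      · exact hbS h
      · exact b.2 h)
  by_cases hxv : x = v
  · subst hxv
    obtain rfl := hv y (H.adj_sub hxy)
    rcases hx with ⟨h, _⟩ | ⟨-, h⟩
    · exact absurd rfl h
    · exact absurd (Or.inl h) hy
  · by_cases hyv : y = v
    · subst hyv
      obtain rfl := hv x (H.adj_sub hxy.symm)
      rcases hx with h | ⟨h, -⟩
      · exact absurd (Or.inr ⟨rfl, h⟩) hy
      · exact absurd h hxv
    · refine ⟨⟨x, hxv⟩, ⟨y, hyv⟩, deleteVert_adj.2 hxy, ?_, fun h => hy (Or.inl ⟨hyv, h⟩)⟩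
      rcases hx with ⟨_, h⟩ | ⟨h, -⟩
      · exact h
      · exact absurd h hxv

theorem Connected.adj_leaf (hv : ∀ x, G.Adj v x → x = w) {H : G.Subgraph} (hH : H.Connected)
    (hvH : v ∈ H.verts) {c : V} (hc : c ∈ H.verts) (hcv : c ≠ v) : H.Adj v w := by
  obtain ⟨y, hy⟩ := hH.exists_adj hvH hc hcv
  exact hv y (H.adj_sub hy) ▸ hy

theorem eq_of_deleteVert_eq {H K : G.Subgraph} (h : H.deleteVert v = K.deleteVert v)
    (hvert : v ∈ H.verts ↔ v ∈ K.verts) (hadj : ∀ x, H.Adj v x ↔ K.Adj v x) : H = K := by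
  ext x y
  · by_cases hx : x = v
    · rw [hx, hvert]
    · exact Set.ext_iff.1 (congrArg verts h) ⟨x, hx⟩
  · by_cases hx : x = v
    · rw [hx, hadj]
    by_cases hy : y = v
    · rw [H.adj_comm, K.adj_comm, hy, hadj]
    · rw [← deleteVert_adj (v := v) (x := ⟨x, hx⟩) (y := ⟨y, hy⟩), h, deleteVert_adj]

theorem deleteVert_injOn_notMem : Set.InjOn (deleteVert v) {H : G.Subgraph | v ∉ H.verts} := by
  intro H hH K hK h
  exact eq_of_deleteVert_eq h (iff_of_false hH hK)
    fun x => iff_of_false (fun h => hH (H.edge_vert h)) fun h => hK (K.edge_vert h)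

/-- The edge `vw` is forced in such subgraphs, so deleting `v` loses no information. -/
theorem deleteVert_injOn_mem (hv : ∀ x, G.Adj v x → x = w) (hwv : w ≠ v) :
    Set.InjOn (deleteVert v)
      {H : G.Subgraph | H.Connected ∧ v ∈ H.verts ∧ w ∈ H.verts} := by
  rintro H ⟨hH, hvH, hwH⟩ K ⟨hK, hvK, hwK⟩ h
  refine eq_of_deleteVert_eq h (iff_of_true hvH hvK) fun x => ⟨fun hx => ?_, fun hx => ?_⟩
  · exact hv x (H.adj_sub hx) ▸ hK.adj_leaf hv hvK hwK hwv
  · exact hv x (K.adj_sub hx) ▸ hH.adj_leaf hv hvH hwH hwv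

theorem Connected.eq_singletonSubgraph {H : G.Subgraph} (hH : H.Connected) (hvH : v ∈ H.verts)
    (h : ∀ x, ¬ H.Adj v x) : H = G.singletonSubgraph v := by
  have hverts : ∀ x ∈ H.verts, x = v := fun x hx => by
    by_contra hxv
    obtain ⟨y, hy⟩ := hH.exists_adj hvH hx hxv
    exact h y hy
  ext x y
  · simp only [singletonSubgraph_verts, Set.mem_singleton_iff]
    exact ⟨hverts x, fun hx => hx ▸ hvH⟩
  · simp only [singletonSubgraph_adj, Pi.bot_apply, Prop.bot_eq_false, iff_false]
    exact fun hxy => h y (hverts x (H.edge_vert hxy) ▸ hxy)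

theorem Connected.eq_singletonSubgraph_of_leaf (hv : ∀ x, G.Adj v x → x = w) {H : G.Subgraph}
    (hH : H.Connected) (hvH : v ∈ H.verts) (hwH : w ∉ H.verts) : H = G.singletonSubgraph v :=
  hH.eq_singletonSubgraph hvH fun x hx =>
    hwH (hv x (H.adj_sub hx) ▸ H.edge_vert hx.symm)

end Subgraph

/-- The connected subgraphs of `G`. -/
def connectedSubgraphs (G : SimpleGraph V) : Set G.Subgraph := {H | H.Connected}

/-- The connected subgraphs of `G` that contain the vertex `u`. -/
def connectedSubgraphsAt (G : SimpleGraph V) (u : V) : Set G.Subgraph :=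
  {H | H.Connected ∧ u ∈ H.verts}

theorem coreIndex_eq_ncard (G : SimpleGraph V) : coreIndex G = G.connectedSubgraphs.ncard := rfl

theorem singletonSubgraph_mem_connectedSubgraphsAt (u : V) :
    G.singletonSubgraph u ∈ G.connectedSubgraphsAt u :=
  ⟨Subgraph.singletonSubgraph_connected, rfl⟩

/-! ### Counting recursions at a leaf -/

section Leaf

variable [Finite V] {v w : V}

theorem ncard_connectedSubgraphs_le_of_leaf (hv : ∀ x, G.Adj v x → x = w) (hwv : w ≠ v) :
    G.connectedSubgraphs.ncard ≤ (G.induce {v}ᶜ).connectedSubgraphs.ncard +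
      ((G.induce {v}ᶜ).connectedSubgraphsAt ⟨w, hwv⟩).ncard + 1 := by
  have hsub : G.connectedSubgraphs ⊆
      ({H | H.Connected ∧ v ∉ H.verts} ∪ {H | H.Connected ∧ v ∈ H.verts ∧ w ∈ H.verts}) ∪
        {G.singletonSubgraph v} := by
    intro H hH
    by_cases hvH : v ∈ H.verts
    · by_cases hwH : w ∈ H.verts
      · exact Or.inl (Or.inr ⟨hH, hvH, hwH⟩)
      · exact Or.inr (Subgraph.Connected.eq_singletonSubgraph_of_leaf hv hH hvH hwH)
    · exact Or.inl (Or.inl ⟨hH, hvH⟩)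
  refine (Set.ncard_le_ncard hsub).trans ((Set.ncard_union_le _ _).trans ?_)
  rw [Set.ncard_singleton]
  refine Nat.add_le_add_right ((Set.ncard_union_le _ _).trans (Nat.add_le_add ?_ ?_)) 1
  · refine Set.ncard_le_ncard_of_injOn (Subgraph.deleteVert v) (fun H hH => ?_)
      (Subgraph.deleteVert_injOn_notMem.mono fun H hH => hH.2)
    obtain ⟨c, hc⟩ := hH.1.nonempty
    exact Subgraph.Connected.deleteVert_of_leaf hv hH.1 hc fun h => hH.2 (h ▸ hc)
  · exact Set.ncard_le_ncard_of_injOn (Subgraph.deleteVert v)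
      (fun H hH => ⟨Subgraph.Connected.deleteVert_of_leaf hv hH.1 hH.2.2 hwv, hH.2.2⟩)
      (Subgraph.deleteVert_injOn_mem hv hwv)

theorem ncard_connectedSubgraphsAt_le_of_leaf (hv : ∀ x, G.Adj v x → x = w) (hwv : w ≠ v)
    {u : V} (huv : u ≠ v) :
    (G.connectedSubgraphsAt u).ncard ≤ ((G.induce {v}ᶜ).connectedSubgraphsAt ⟨u, huv⟩).ncard +
      ((G.induce {v}ᶜ).connectedSubgraphsAt ⟨u, huv⟩ ∩ {H | ⟨w, hwv⟩ ∈ H.verts}).ncard := by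
  have hsub : G.connectedSubgraphsAt u ⊆
      {H | (H.Connected ∧ u ∈ H.verts) ∧ v ∉ H.verts} ∪
        {H | (H.Connected ∧ u ∈ H.verts) ∧ v ∈ H.verts ∧ w ∈ H.verts} := by
    intro H hH
    by_cases hvH : v ∈ H.verts
    · refine Or.inr ⟨hH, hvH, ?_⟩
      exact H.edge_vert (Subgraph.Connected.adj_leaf hv hH.1 hvH hH.2 huv).symm
    · exact Or.inl ⟨hH, hvH⟩
  refine (Set.ncard_le_ncard hsub).trans ((Set.ncard_union_le _ _).trans (Nat.add_le_add ?_ ?_))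
  · exact Set.ncard_le_ncard_of_injOn (Subgraph.deleteVert v)
      (fun H hH => ⟨Subgraph.Connected.deleteVert_of_leaf hv hH.1.1 hH.1.2 huv, hH.1.2⟩)
      (Subgraph.deleteVert_injOn_notMem.mono fun H hH => hH.2)
  · exact Set.ncard_le_ncard_of_injOn (Subgraph.deleteVert v)
      (fun H hH => Set.mem_inter
        ⟨Subgraph.Connected.deleteVert_of_leaf hv hH.1.1 hH.1.2 huv, hH.1.2⟩ hH.2.2)
      (fun H hH K hK => Subgraph.deleteVert_injOn_mem hv hwv ⟨hH.1.1, hH.2⟩ ⟨hK.1.1, hK.2⟩)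

theorem ncard_connectedSubgraphsAt_leaf_le (hv : ∀ x, G.Adj v x → x = w) (hwv : w ≠ v) :
    (G.connectedSubgraphsAt v).ncard ≤
      ((G.induce {v}ᶜ).connectedSubgraphsAt ⟨w, hwv⟩).ncard + 1 := by
  have hsub : G.connectedSubgraphsAt v ⊆
      {H | H.Connected ∧ v ∈ H.verts ∧ w ∈ H.verts} ∪ {G.singletonSubgraph v} := by
    intro H hH
    by_cases hwH : w ∈ H.verts
    · exact Or.inl ⟨hH.1, hH.2, hwH⟩
    · exact Or.inr (Subgraph.Connected.eq_singletonSubgraph_of_leaf hv hH.1 hH.2 hwH)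
  refine (Set.ncard_le_ncard hsub).trans ((Set.ncard_union_le _ _).trans ?_)
  rw [Set.ncard_singleton]
  refine Nat.add_le_add_right ?_ 1
  exact Set.ncard_le_ncard_of_injOn (Subgraph.deleteVert v)
    (fun H hH => ⟨Subgraph.Connected.deleteVert_of_leaf hv hH.1 hH.2.2 hwv, hH.2.2⟩)
    (Subgraph.deleteVert_injOn_mem hv hwv)

end Leaf

end SimpleGraph

/-! ### Counting connected subgraphs by their edge sets -/

namespace SimpleGraph

variable {V : Type*} {G : SimpleGraph V}

/-- Every vertex other than `u` must be an endpoint of an edge; the common vertex `u` settles the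
edgeless case. -/
theorem Subgraph.Connected.eq_of_edgeSet_eq {H K : G.Subgraph} (hH : H.Connected)
    (hK : K.Connected) {u : V} (huH : u ∈ H.verts) (huK : u ∈ K.verts)
    (h : H.edgeSet = K.edgeSet) : H = K := by
  have hadj : ∀ x y, H.Adj x y ↔ K.Adj x y := fun x y => by
    rw [← Subgraph.mem_edgeSet, h, Subgraph.mem_edgeSet]
  ext x y
  · by_cases hxu : x = u
    · rw [hxu]
      exact iff_of_true huH huK
    constructor
    · intro hx
      obtain ⟨y, hy⟩ := hH.exists_adj hx huH (Ne.symm hxu)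
      exact K.edge_vert ((hadj _ _).1 hy)
    · intro hx
      obtain ⟨y, hy⟩ := hK.exists_adj hx huK (Ne.symm hxu)
      exact H.edge_vert ((hadj _ _).2 hy)
  · exact hadj x y

section Finite

open Classical in
/-- The finite set of edges of a subgraph of a finite graph. -/
noncomputable def Subgraph.edgeFinset [Fintype V] (H : G.Subgraph) : Finset (Sym2 V) :=
  H.edgeSet.toFinset

variable [Fintype V]

@[simp] theorem Subgraph.mem_edgeFinset {H : G.Subgraph} {e : Sym2 V} :
    e ∈ H.edgeFinset ↔ e ∈ H.edgeSet := by
  simp [Subgraph.edgeFinset]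

theorem Subgraph.Connected.eq_of_edgeFinset_eq {H K : G.Subgraph} (hH : H.Connected)
    (hK : K.Connected) {u : V} (huH : u ∈ H.verts) (huK : u ∈ K.verts)
    (h : H.edgeFinset = K.edgeFinset) : H = K :=
  hH.eq_of_edgeSet_eq hK huH huK (by ext e; rw [← mem_edgeFinset, h, mem_edgeFinset])

theorem Subgraph.Connected.eq_of_edgeFinset_eq_of_nonempty {H K : G.Subgraph} (hH : H.Connected)
    (hK : K.Connected) (hne : H.edgeFinset.Nonempty) (h : H.edgeFinset = K.edgeFinset) :
    H = K := by
  obtain ⟨e, he⟩ := hne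
  induction e with
  | _ x y =>
    refine hH.eq_of_edgeFinset_eq hK (u := x) ?_ ?_ h
    · exact H.edge_vert (Subgraph.mem_edgeFinset.1 he)
    · exact K.edge_vert (Subgraph.mem_edgeFinset.1 (h ▸ he))

open Classical in
theorem Subgraph.edgeFinset_subset (H : G.Subgraph) : H.edgeFinset ⊆ G.edgeFinset := fun e he => by
  rw [SimpleGraph.mem_edgeFinset]
  exact H.edgeSet_subset (Subgraph.mem_edgeFinset.1 he)

open Classical in
-- The nonempty edge sets with no edge at `u` cannot occur. The empty set does occur, for `u` alone,
-- whence the `+ 1`.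
theorem ncard_connectedSubgraphsAt_add_le (u : V) :
    (G.connectedSubgraphsAt u).ncard + 2 ^ (G.edgeFinset.card - G.degree u) ≤
      2 ^ G.edgeFinset.card + 1 := by
  set E := G.edgeFinset
  set B : Finset (Finset (Sym2 V)) := (E \ G.incidenceFinset u).powerset.erase ∅ with hB
  have hBE : B ⊆ E.powerset := fun A hA => by
    rw [hB, Finset.mem_erase, Finset.mem_powerset] at hA
    exact Finset.mem_powerset.2 (hA.2.trans Finset.sdiff_subset)
  have hBcard : B.card + 1 = 2 ^ (E.card - G.degree u) := by
    rw [hB, Finset.card_erase_add_one (Finset.empty_mem_powerset _), Finset.card_powerset,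
      Finset.card_sdiff_of_subset (G.incidenceFinset_subset u), card_incidenceFinset_eq_degree]
  have key : (G.connectedSubgraphsAt u).ncard ≤ (E.powerset \ B).card := by
    rw [← Set.ncard_coe_finset]
    refine Set.ncard_le_ncard_of_injOn Subgraph.edgeFinset (fun H hH => ?_)
      fun H hH K hK h => hH.1.eq_of_edgeFinset_eq hK.1 hH.2 hK.2 h
    rw [Finset.mem_coe, Finset.mem_sdiff, Finset.mem_powerset]
    refine ⟨H.edgeFinset_subset, fun hHB => ?_⟩
    rw [hB, Finset.mem_erase, Finset.mem_powerset, ← Finset.nonempty_iff_ne_empty] at hHB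
    obtain ⟨⟨e, he⟩, hsub⟩ := hHB
    have hu : ∀ y, ¬ H.Adj u y := fun y hy => by
      have := hsub (Subgraph.mem_edgeFinset.2 (Subgraph.mem_edgeSet.2 hy))
      rw [Finset.mem_sdiff, mem_incidenceFinset] at this
      exact this.2 ⟨H.adj_sub hy, Sym2.mem_mk_left _ _⟩
    rw [hH.1.eq_singletonSubgraph hH.2 hu] at he
    simp at he
  have h2 := Finset.card_sdiff_add_card_eq_card hBE
  rw [Finset.card_powerset] at h2
  omega

open Classical in
/-- The edges of `G` other than `e` that share a vertex with `e`. -/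
noncomputable def adjacentEdges (G : SimpleGraph V) (e : Sym2 V) : Finset (Sym2 V) :=
  G.edgeFinset.filter fun f => f ≠ e ∧ ∃ x ∈ e, x ∈ f

open Classical in
theorem card_adjacentEdges_le {x y : V} (h : G.Adj x y) :
    (G.adjacentEdges s(x, y)).card ≤ (G.degree x - 1) + (G.degree y - 1) := by
  have hsub : G.adjacentEdges s(x, y) ⊆
      (G.incidenceFinset x).erase s(x, y) ∪ (G.incidenceFinset y).erase s(x, y) := by
    intro f hf
    rw [adjacentEdges, Finset.mem_filter, SimpleGraph.mem_edgeFinset] at hf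
    obtain ⟨hfE, hne, z, hz, hzf⟩ := hf
    rw [Finset.mem_union, Finset.mem_erase, Finset.mem_erase, mem_incidenceFinset,
      mem_incidenceFinset]
    rcases Sym2.mem_iff.1 hz with rfl | rfl
    · exact Or.inl ⟨hne, hfE, hzf⟩
    · exact Or.inr ⟨hne, hfE, hzf⟩
  refine (Finset.card_le_card hsub).trans ((Finset.card_union_le _ _).trans ?_)
  rw [Finset.card_erase_of_mem, Finset.card_erase_of_mem, card_incidenceFinset_eq_degree,
    card_incidenceFinset_eq_degree]
  · exact (mem_incidenceFinset _ _ _).2 ⟨h, Sym2.mem_mk_right _ _⟩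
  · exact (mem_incidenceFinset _ _ _).2 ⟨h, Sym2.mem_mk_left _ _⟩

/-- No edge of `H` leaves the endpoints of `e`, so they are all of `H`. -/
theorem Subgraph.Connected.edgeFinset_eq_singleton {H : G.Subgraph} (hH : H.Connected)
    {e : Sym2 V} (he : e ∈ H.edgeFinset) (hdisj : Disjoint H.edgeFinset (G.adjacentEdges e)) :
    H.edgeFinset = {e} := by
  classical
  have hcl : ∀ x ∈ e, ∀ y, H.Adj x y → s(x, y) = e := fun x hx y hxy => by
    by_contra hne
    refine Finset.disjoint_left.1 hdisj (Subgraph.mem_edgeFinset.2 (Subgraph.mem_edgeSet.2 hxy)) ?_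
    rw [adjacentEdges, Finset.mem_filter, SimpleGraph.mem_edgeFinset]
    exact ⟨H.adj_sub hxy, hne, x, hx, Sym2.mem_mk_left _ _⟩
  have hverts : ∀ x ∈ H.verts, x ∈ e := by
    intro x hx
    by_contra hxe
    obtain ⟨a, ha⟩ : ∃ a, a ∈ e := ⟨_, Sym2.out_fst_mem e⟩
    have haH : a ∈ H.verts := H.mem_verts_of_mem_edge (Subgraph.mem_edgeFinset.1 he) ha
    obtain ⟨y, z, hyz, hy, hz⟩ :=
      hH.exists_adj_of_mem_of_notMem (S := {x | x ∈ e}) haH ha hx hxe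
    exact hz ((hcl y hy z hyz).subst (motive := fun f => z ∈ f) (Sym2.mem_mk_right y z))
  refine Finset.eq_singleton_iff_unique_mem.2 ⟨he, fun f hf => ?_⟩
  induction f with
  | _ x y =>
    exact hcl x (hverts x (H.edge_vert (Subgraph.mem_edgeFinset.1 hf))) y
      (Subgraph.mem_edgeFinset.1 hf)

open Classical in
-- Edgeless connected subgraphs are single vertices. Among nonempty edge sets, those in which an
-- edge `e` is isolated but not alone are excluded, for two choices of `e` sharing the vertex `x`.
-- Each choice excludes at least `2 ^ (|E| - 3) - 1` sets, as at most two edges are adjacent to `e`.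
theorem coreIndex_add_le_of_degree_eq_two (hdeg : ∀ x, G.degree x = 2) [Nonempty V]
    (hcard : 3 ≤ G.edgeFinset.card) :
    coreIndex G + 2 ^ (G.edgeFinset.card - 2) ≤
      Fintype.card V + 2 ^ G.edgeFinset.card + 1 := by
  set E := G.edgeFinset with hE
  obtain ⟨x⟩ := ‹Nonempty V›
  obtain ⟨y, z, hyz, hN⟩ := Finset.card_eq_two.1 (hdeg x)
  have hy : G.Adj x y := (G.mem_neighborFinset x y).1 (by rw [hN]; simp)
  have hz : G.Adj x z := (G.mem_neighborFinset x z).1 (by rw [hN]; simp)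
  let B : Sym2 V → Finset (Finset (Sym2 V)) := fun e =>
    (Finset.Icc {e} (E \ G.adjacentEdges e)).erase {e}
  have hBmem : ∀ e A, A ∈ B e ↔ A ≠ {e} ∧ e ∈ A ∧ A ⊆ E \ G.adjacentEdges e := fun e A => by
    simp only [B, Finset.mem_erase, Finset.mem_Icc,
      Finset.singleton_subset_iff]
  have hBcard : ∀ y, G.Adj x y → 2 ^ (E.card - 3) ≤ (B s(x, y)).card + 1 := by
    intro y hxy
    have hsub : {s(x, y)} ⊆ E \ G.adjacentEdges s(x, y) := by
      rw [Finset.singleton_subset_iff, Finset.mem_sdiff, hE, SimpleGraph.mem_edgeFinset]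
      exact ⟨hxy, fun h => (Finset.mem_filter.1 h).2.1 rfl⟩
    have h1 := card_adjacentEdges_le hxy
    rw [hdeg, hdeg] at h1
    have h2 := Finset.card_sdiff_of_subset
      (show G.adjacentEdges s(x, y) ⊆ E from Finset.filter_subset _ _)
    rw [Finset.card_erase_add_one (Finset.mem_Icc.2 ⟨le_rfl, hsub⟩),
      Finset.card_Icc_finset hsub, Finset.card_singleton, h2]
    exact Nat.pow_le_pow_right (by norm_num) (by omega)
  -- The two edges meet at `x`, so neither can be isolated in a set containing both.
  have hdisj : Disjoint (B s(x, y)) (B s(x, z)) := by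
    rw [Finset.disjoint_left]
    intro A hA hA'
    have h1 := ((hBmem _ _).1 hA).2.2 ((hBmem _ _).1 hA').2.1
    rw [Finset.mem_sdiff, adjacentEdges, Finset.mem_filter] at h1
    refine h1.2 ⟨h1.1, fun h => hyz ?_, x, Sym2.mem_mk_left _ _, Sym2.mem_mk_left _ _⟩
    simpa [hy.ne, hz.ne, eq_comm] using h
  set C := B s(x, y) ∪ B s(x, z) with hC
  have hCE : C ⊆ E.powerset.erase ∅ := fun A hA => by
    rw [Finset.mem_erase, Finset.mem_powerset]
    rcases Finset.mem_union.1 hA with h | h <;> rw [hBmem] at h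
    · exact ⟨Finset.ne_empty_of_mem h.2.1, h.2.2.trans Finset.sdiff_subset⟩
    · exact ⟨Finset.ne_empty_of_mem h.2.1, h.2.2.trans Finset.sdiff_subset⟩
  have hsplit : G.connectedSubgraphs ⊆ Set.range G.singletonSubgraph ∪
      {H | H.Connected ∧ H.edgeFinset.Nonempty} := by
    intro H hH
    by_cases hne : H.edgeFinset.Nonempty
    · exact Or.inr ⟨hH, hne⟩
    · obtain ⟨v, hv⟩ := Subgraph.Connected.nonempty hH
      refine Or.inl ⟨v, (Subgraph.Connected.eq_singletonSubgraph hH hv fun t ht => hne ?_).symm⟩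
      exact ⟨s(v, t), Subgraph.mem_edgeFinset.2 ht⟩
  have hsing : (Set.range G.singletonSubgraph).ncard ≤ Fintype.card V := by
    rw [← Set.image_univ, ← Nat.card_eq_fintype_card, ← Set.ncard_univ]
    exact Set.ncard_image_le
  have hne : {H : G.Subgraph | H.Connected ∧ H.edgeFinset.Nonempty}.ncard ≤
      (E.powerset.erase ∅ \ C).card := by
    rw [← Set.ncard_coe_finset]
    refine Set.ncard_le_ncard_of_injOn Subgraph.edgeFinset (fun H hH => ?_)
      fun H hH K hK h => hH.1.eq_of_edgeFinset_eq_of_nonempty hK.1 hH.2 h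
    rw [Finset.mem_coe, Finset.mem_sdiff, Finset.mem_erase, Finset.mem_powerset]
    refine ⟨⟨hH.2.ne_empty, H.edgeFinset_subset⟩, fun hHC => ?_⟩
    rcases Finset.mem_union.1 hHC with h | h <;> rw [hBmem] at h <;>
    exact h.1 (hH.1.edgeFinset_eq_singleton h.2.1
      (Finset.disjoint_of_subset_left h.2.2 Finset.sdiff_disjoint))
  have h1 := Finset.card_sdiff_add_card_eq_card hCE
  have h2 := Finset.card_erase_add_one (Finset.empty_mem_powerset E)
  rw [Finset.card_powerset] at h2
  have h3 := Finset.card_union_of_disjoint hdisj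
  rw [← hC] at h3
  have h4 := hBcard y hy
  have h5 := hBcard z hz
  have h6 : (2 : ℕ) ^ (E.card - 2) = 2 * 2 ^ (E.card - 3) := by
    rw [← pow_succ']
    congr 1
    omega
  have h7 := (Set.ncard_le_ncard hsplit).trans (Set.ncard_union_le _ _)
  rw [coreIndex_eq_ncard]
  omega

end Finite

end SimpleGraph

/-! ### The upper bounds by induction on leaves -/

namespace SimpleGraph

variable {V : Type*} [Fintype V] {G : SimpleGraph V}

open Classical in
theorem _root_.IsUnicyclic.card_edgeFinset (h : IsUnicyclic G) :
    G.edgeFinset.card = Fintype.card V := by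
  rw [← h.2, Set.ncard_eq_toFinset_card', edgeFinset]

theorem _root_.IsUnicyclic.three_le_card (h : IsUnicyclic G) : 3 ≤ Fintype.card V := by
  classical
  have h1 := G.card_edgeFinset_le_card_choose_two
  rw [h.card_edgeFinset] at h1
  have h2 : 0 < Fintype.card V := Fintype.card_pos_iff.2 h.1.nonempty
  by_contra hlt
  generalize Fintype.card V = m at *
  have : m = 1 ∨ m = 2 := by omega
  rcases this with rfl | rfl <;> simp [Nat.choose] at h1

open Classical in
-- The degrees sum to `2n`, so if all are at least 2 they all equal 2.
theorem _root_.IsUnicyclic.exists_degree_eq_one_or (h : IsUnicyclic G) :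
    (∃ v, G.degree v = 1) ∨ ∀ v, G.degree v = 2 := by
  by_contra! hcon
  obtain ⟨h1, v, hv⟩ := hcon
  have h3 := h.three_le_card
  have : Nontrivial V := Fintype.one_lt_card_iff_nontrivial.1 (by omega)
  have hge : ∀ x ∈ Finset.univ, 2 ≤ G.degree x := fun x _ => by
    have := h.1.preconnected.degree_pos_of_nontrivial x
    have := h1 x
    omega
  have hsum := G.sum_degrees_eq_twice_card_edges
  rw [h.card_edgeFinset] at hsum
  have heq := (Finset.sum_eq_sum_iff_of_le hge).1 (by
    rw [hsum, Finset.sum_const, Finset.card_univ, smul_eq_mul, mul_comm])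
  exact hv (heq v (Finset.mem_univ v)).symm

open Classical in
theorem _root_.IsUnicyclic.induce_of_degree_eq_one (h : IsUnicyclic G) {v : V}
    (hv : G.degree v = 1) :
    IsUnicyclic (G.induce {v}ᶜ) ∧ Fintype.card ({v}ᶜ : Set V) + 1 = Fintype.card V := by
  have hpos := h.three_le_card
  have hc : Fintype.card ({v}ᶜ : Set V) = Fintype.card V - 1 := by
    rw [Fintype.card_compl_set, Set.card_singleton]
  refine ⟨⟨h.1.induce_compl_singleton_of_degree_eq_one hv, ?_⟩, by omega⟩
  have h1 := G.card_edgeFinset_induce_compl_singleton v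
  rw [card_edgeFinset_deleteIncidenceSet, hv, h.card_edgeFinset] at h1
  rw [hc, ← h1, edgeFinset, Set.ncard_eq_toFinset_card']

open Classical in
theorem exists_leaf_of_degree_eq_one {v : V} (hv : G.degree v = 1) :
    ∃ w, w ≠ v ∧ G.Adj v w ∧ ∀ x, G.Adj v x → x = w := by
  obtain ⟨w, hw, huniq⟩ := degree_eq_one_iff_existsUnique_adj.1 hv
  exact ⟨w, hw.ne', hw, huniq⟩

theorem _root_.IsUnicyclic.ncard_connectedSubgraphsAt_le.{u} (n : ℕ) :
    ∀ (V : Type u) [Fintype V] (G : SimpleGraph V), Fintype.card V = n → IsUnicyclic G →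
      ∀ r : V, (G.connectedSubgraphsAt r).ncard ≤ 7 * 2 ^ (n - 3) ∧
        ((G.connectedSubgraphsAt r).ncard = 7 * 2 ^ (n - 3) → ∀ x, x ≠ r → G.Adj r x) := by
  classical
  induction n with
  | zero =>
    intro V _ G hn h
    have := h.three_le_card
    omega
  | succ n ih =>
    intro V _ G hn h r
    have h3 := h.three_le_card
    rcases h.exists_degree_eq_one_or with ⟨v, hv⟩ | hdeg
    · obtain ⟨h', hcard⟩ := h.induce_of_degree_eq_one hv
      obtain ⟨w, hwv, hvw, hleaf⟩ := exists_leaf_of_degree_eq_one hv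
      have hn' : Fintype.card ({v}ᶜ : Set V) = n := by omega
      have h3' := h'.three_le_card
      have hpow : 2 ^ (n + 1 - 3) = 2 * 2 ^ (n - 3) := by
        rw [← pow_succ']
        congr 1
        omega
      have hpos : 0 < 2 ^ (n - 3) := by positivity
      rw [hpow]
      by_cases hrv : r = v
      · subst hrv
        have h1 := ncard_connectedSubgraphsAt_leaf_le hleaf hwv
        have h2 := (ih _ (G.induce {r}ᶜ) hn' h' ⟨w, hwv⟩).1
        exact ⟨by omega, fun h => by omega⟩
      · have h1 := ncard_connectedSubgraphsAt_le_of_leaf hleaf hwv hrv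
        have h2 := ih _ (G.induce {v}ᶜ) hn' h' ⟨r, hrv⟩
        by_cases hrw : r = w
        · subst hrw
          have h4 := Set.ncard_inter_le_ncard_left
            ((G.induce {v}ᶜ).connectedSubgraphsAt ⟨r, hrv⟩) {H | ⟨r, hwv⟩ ∈ H.verts}
          refine ⟨by omega, fun heq x hx => ?_⟩
          by_cases hxv : x = v
          · exact hxv ▸ hvw.symm
          · exact h2.2 (by omega) ⟨x, hxv⟩ fun h => hx (congrArg Subtype.val h)
        -- The single vertex `r` is a connected subgraph missing `w`, so the doubling is strict.
        · have h4 : ((G.induce {v}ᶜ).connectedSubgraphsAt ⟨r, hrv⟩ ∩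
              {H | ⟨w, hwv⟩ ∈ H.verts}).ncard <
              ((G.induce {v}ᶜ).connectedSubgraphsAt ⟨r, hrv⟩).ncard := by
            refine Set.ncard_lt_ncard ⟨Set.inter_subset_left, fun hsub => ?_⟩
            have := (hsub (singletonSubgraph_mem_connectedSubgraphsAt _)).2
            exact hrw (congrArg Subtype.val (show _ = _ from this)).symm
          exact ⟨by omega, fun h => by omega⟩
    · have h1 := G.ncard_connectedSubgraphsAt_add_le r
      rw [h.card_edgeFinset, hn, hdeg] at h1
      obtain ⟨k, rfl⟩ : ∃ k, n = k + 2 := ⟨n - 2, by omega⟩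
      have e1 : k + 2 + 1 - 3 = k := by omega
      have e2 : k + 2 + 1 - 2 = k + 1 := by omega
      rw [e2, pow_succ, pow_succ, pow_succ] at h1
      rw [e1]
      have hpos : 0 < 2 ^ k := by positivity
      refine ⟨by omega, fun heq => ?_⟩
      -- There are `k + 3` vertices and `h1` bounds the count by `6 * 2 ^ k + 1`, which reaches `7 *
      -- 2 ^ k` only for the triangle.
      have hk : k = 0 := by
        by_contra hk
        have := Nat.pow_le_pow_right (n := 2) (by norm_num) (Nat.one_le_iff_ne_zero.2 hk)
        omega
      subst hk
      intro x hx
      have huniv : insert r (G.neighborFinset r) = Finset.univ := by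
        rw [← Finset.card_eq_iff_eq_univ, Finset.card_insert_of_notMem (by simp),
          card_neighborFinset_eq_degree, hdeg, hn]
      have := huniv ▸ Finset.mem_univ x
      rw [Finset.mem_insert, mem_neighborFinset] at this
      exact this.resolve_left hx

theorem _root_.IsUnicyclic.coreIndex_le.{u} (n : ℕ) :
    ∀ (V : Type u) [Fintype V] (G : SimpleGraph V), Fintype.card V = n → IsUnicyclic G →
      coreIndex G ≤ 7 * 2 ^ (n - 3) + n ∧
        (4 ≤ n → coreIndex G = 7 * 2 ^ (n - 3) + n → ∃ r, ∀ x, x ≠ r → G.Adj r x) := by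
  classical
  induction n with
  | zero =>
    intro V _ G hn h
    have := h.three_le_card
    omega
  | succ n ih =>
    intro V _ G hn h
    have h3 := h.three_le_card
    rcases h.exists_degree_eq_one_or with ⟨v, hv⟩ | hdeg
    · obtain ⟨h', hcard⟩ := h.induce_of_degree_eq_one hv
      obtain ⟨w, hwv, hvw, hleaf⟩ := exists_leaf_of_degree_eq_one hv
      have hn' : Fintype.card ({v}ᶜ : Set V) = n := by omega
      have h3' := h'.three_le_card
      have hpow : 2 ^ (n + 1 - 3) = 2 * 2 ^ (n - 3) := by
        rw [← pow_succ']
        congr 1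
        omega
      rw [hpow]
      have h1 := ncard_connectedSubgraphs_le_of_leaf hleaf hwv
      rw [← coreIndex_eq_ncard, ← coreIndex_eq_ncard] at h1
      have h2 := (ih _ (G.induce {v}ᶜ) hn' h').1
      have h4 := IsUnicyclic.ncard_connectedSubgraphsAt_le n _ (G.induce {v}ᶜ) hn' h' ⟨w, hwv⟩
      -- Equality forces the rooted bound at `w` to be tight, so `w` is adjacent to all of `G - v`,
      -- and to `v` as well.
      refine ⟨by omega, fun _ heq => ⟨w, fun x hx => ?_⟩⟩
      by_cases hxv : x = v
      · exact hxv ▸ hvw.symm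
      · exact h4.2 (by omega) ⟨x, hxv⟩ fun h => hx (congrArg Subtype.val h)
    · have := h.1.nonempty
      have h1 := coreIndex_add_le_of_degree_eq_two hdeg (by rwa [h.card_edgeFinset])
      rw [h.card_edgeFinset, hn] at h1
      obtain ⟨k, rfl⟩ : ∃ k, n = k + 2 := ⟨n - 2, by omega⟩
      have e1 : k + 2 + 1 - 3 = k := by omega
      have e2 : k + 2 + 1 - 2 = k + 1 := by omega
      rw [e2, pow_succ, pow_succ, pow_succ] at h1
      rw [e1]
      have hpos : 0 < 2 ^ k := by positivity
      refine ⟨by omega, fun hk heq => ?_⟩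
      have := Nat.pow_le_pow_right (n := 2) (by norm_num) (show 1 ≤ k by omega)
      omega

end SimpleGraph

/-! ### Pineapples as stars with one extra edge -/

namespace SimpleGraph

variable {V : Type*} {G : SimpleGraph V}

/-- The edges of `G` are those at the vertex `u` together with the edge `ab`, where `u` is adjacent
to all other vertices and `u`, `a`, `b` are distinct. -/
structure IsPineapple (G : SimpleGraph V) (u a b : V) : Prop where
  ne_left : a ≠ u
  ne_right : b ≠ u
  ne : a ≠ b
  adj_iff : ∀ x y, G.Adj x y ↔ x ≠ y ∧ (x = u ∨ y = u ∨ s(x, y) = s(a, b))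

theorem isPineapple_pineapple {n : ℕ} (hn : 3 ≤ n) :
    (pineapple n 3).IsPineapple ⟨0, by omega⟩ ⟨1, by omega⟩ ⟨2, by omega⟩ := by
  refine ⟨by simp, by simp, by simp, fun x y => ?_⟩
  simp only [pineapple, fromRel_adj, Sym2.eq_iff, Fin.ext_iff, ne_eq]
  omega

/-- The vertex `u` accounts for `n - 1` of the `n` edges, leaving exactly one edge `ab`. -/
theorem _root_.IsUnicyclic.exists_isPineapple [Fintype V] (h : IsUnicyclic G) {u : V}
    (hu : ∀ x, x ≠ u → G.Adj u x) : ∃ a b, G.IsPineapple u a b := by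
  classical
  have hdeg : G.degree u + 1 = Fintype.card V := by
    have huniv : insert u (G.neighborFinset u) = Finset.univ :=
      Finset.eq_univ_of_forall fun x => by
        rw [Finset.mem_insert, mem_neighborFinset]
        exact or_iff_not_imp_left.2 (hu x)
    rw [← card_neighborFinset_eq_degree, ← Finset.card_insert_of_notMem (G.notMem_neighborFinset_self u), huniv,
      Finset.card_univ]
  have hcard : (G.edgeFinset \ G.incidenceFinset u).card = 1 := by
    rw [Finset.card_sdiff_of_subset (G.incidenceFinset_subset u), card_incidenceFinset_eq_degree,
      h.card_edgeFinset]
    omega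
  obtain ⟨e, he⟩ := Finset.card_eq_one.1 hcard
  induction e with
  | _ a b =>
    have hmem : ∀ x y, (G.Adj x y ∧ ¬ (u = x ∨ u = y)) ↔ s(x, y) = s(a, b) := fun x y => by
      rw [← Finset.mem_singleton (a := s(a, b)), ← he, Finset.mem_sdiff, SimpleGraph.mem_edgeFinset,
        mem_incidenceFinset, mem_edgeSet, incidenceSet, Set.mem_sep_iff, mem_edgeSet, Sym2.mem_iff]
      tauto
    have hab := (hmem a b).2 rfl
    refine ⟨a, b, fun h => hab.2 (Or.inl h.symm), fun h => hab.2 (Or.inr h.symm), hab.1.ne,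
      fun x y => ?_⟩
    rw [← hmem]
    constructor
    · intro hxy
      refine ⟨hxy.ne, ?_⟩
      tauto
    · rintro ⟨hne, rfl | rfl | hxy⟩
      · exact hu y hne.symm
      · exact (hu x hne).symm
      · exact hxy.1

namespace IsPineapple

variable {u a b : V}

theorem adj_hub (h : G.IsPineapple u a b) {x : V} (hx : x ≠ u) : G.Adj u x :=
  (h.adj_iff u x).2 ⟨hx.symm, Or.inl rfl⟩

theorem adj_pair (h : G.IsPineapple u a b) : G.Adj a b :=
  (h.adj_iff a b).2 ⟨h.ne, Or.inr (Or.inr rfl)⟩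

/-- Adjacency depends only on `u`, `a`, `b`, so any bijection matching these triples is an
isomorphism. -/
theorem nonempty_iso [Fintype V] {W : Type*} [Fintype W] {K : SimpleGraph W} {u' a' b' : W}
    (h : G.IsPineapple u a b) (h' : K.IsPineapple u' a' b')
    (hcard : Fintype.card V = Fintype.card W) : Nonempty (G ≃g K) := by
  classical
  obtain ⟨g, hg⟩ := Finset.exists_equiv_extend_of_card_eq (α := V) (t := (Finset.univ : Finset W))
    (by rw [hcard, Finset.card_univ]) (s := {u, a, b})
    (f := fun x => if x = u then u' else if x = a then a' else b') (Finset.subset_univ _) (by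
      intro x hx y hy hxy
      have := h.ne_left
      have := h.ne_right
      have := h.ne
      have := h'.ne_left
      have := h'.ne_right
      have := h'.ne
      simp only [Finset.coe_insert, Finset.coe_singleton, Set.mem_insert_iff,
        Set.mem_singleton_iff] at hx hy
      grind)
  let e : V ≃ W := g.trans (Equiv.subtypeUnivEquiv fun x => Finset.mem_univ x)
  have hu : e u = u' := by
    change (g u : W) = u'
    simpa using hg u (by simp)
  have ha : e a = a' := by
    change (g a : W) = a'
    simpa [h.ne_left] using hg a (by simp)
  have hb : e b = b' := by
    change (g b : W) = b'
    simpa [h.ne_right, h.ne.symm] using hg b (by simp)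
  refine ⟨⟨e, fun {x y} => ?_⟩⟩
  rw [h.adj_iff, h'.adj_iff, ← hu, ← ha, ← hb, ← Sym2.map_mk, ← Sym2.map_mk]
  simp only [ne_eq, e.injective.eq_iff, (Sym2.map.injective e.injective).eq_iff]

theorem isUnicyclic [Fintype V] (h : G.IsPineapple u a b) : IsUnicyclic G := by
  classical
  have hconn : G.Connected := by
    have hr : ∀ x, G.Reachable u x := fun x => by
      by_cases hx : x = u
      · exact hx ▸ Reachable.refl _
      · exact (h.adj_hub hx).reachable
    have : Nonempty V := ⟨u⟩
    exact ⟨fun x y => (hr x).symm.trans (hr y)⟩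
  refine ⟨hconn, ?_⟩
  have hE : G.edgeSet = insert s(a, b) ((fun x => s(u, x)) '' {u}ᶜ) := by
    ext e
    induction e with
    | _ x y =>
      rw [mem_edgeSet, h.adj_iff, Set.mem_insert_iff]
      constructor
      · rintro ⟨hxy, rfl | rfl | he⟩
        · exact Or.inr ⟨y, hxy.symm, rfl⟩
        · exact Or.inr ⟨x, hxy, Sym2.eq_swap⟩
        · exact Or.inl he
      · rintro (he | ⟨z, hz, he⟩)
        · refine ⟨fun hxy => h.ne ?_, Or.inr (Or.inr he)⟩
          rw [Sym2.eq_iff] at he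
          grind
        · have hzu : z ≠ u := hz
          rw [Sym2.eq_iff] at he
          grind
  rw [hE, Set.ncard_insert_of_notMem, Set.ncard_image_of_injective, Set.ncard_compl,
    Set.ncard_singleton, Nat.card_eq_fintype_card]
  · have : 0 < Fintype.card V := Fintype.card_pos_iff.2 ⟨u⟩
    omega
  · intro x y hxy
    exact Sym2.congr_right.1 hxy
  · rintro ⟨x, -, hx⟩
    have := h.ne_left
    have := h.ne_right
    rw [Sym2.eq_iff] at hx
    grind

end IsPineapple

/-! ### The lower bound for the pineapple -/

/-- The subgraph of `G` with the vertex `u`, the edges in `A` and the endpoints of these edges. -/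
def subgraphOfEdges (G : SimpleGraph V) (u : V) (A : Finset (Sym2 V)) : G.Subgraph where
  verts := {x | x = u ∨ ∃ y, G.Adj x y ∧ s(x, y) ∈ A}
  Adj x y := G.Adj x y ∧ s(x, y) ∈ A
  adj_sub h := h.1
  edge_vert h := Or.inr ⟨_, h⟩
  symm := ⟨fun _ _ h => ⟨h.1.symm, Sym2.eq_swap ▸ h.2⟩⟩

open Classical in
theorem subgraphOfEdges_injOn [Fintype V] (u : V) :
    Set.InjOn (G.subgraphOfEdges u) (G.edgeFinset.powerset : Set (Finset (Sym2 V))) := by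
  intro A hA B hB hAB
  rw [Finset.mem_coe, Finset.mem_powerset] at hA hB
  ext e
  induction e with
  | _ x y =>
    have hxy : (G.Adj x y ∧ s(x, y) ∈ A) = (G.Adj x y ∧ s(x, y) ∈ B) :=
      congrFun (congrFun (congrArg Subgraph.Adj hAB) x) y
    constructor
    · intro h
      exact (hxy.mp ⟨SimpleGraph.mem_edgeFinset.1 (hA h), h⟩).2
    · intro h
      exact (hxy.mpr ⟨SimpleGraph.mem_edgeFinset.1 (hB h), h⟩).2

namespace IsPineapple

variable {u a b : V}

/-- Only the edge `ab` misses `u`, and the hypothesis ties it to `u`. -/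
theorem connected_subgraphOfEdges (h : G.IsPineapple u a b) {A : Finset (Sym2 V)}
    (hA : s(a, b) ∈ A → s(u, a) ∈ A ∨ s(u, b) ∈ A) : (G.subgraphOfEdges u A).Connected := by
  have key : ∀ (S : Set V) (q : V), u ∈ S → q ∈ (G.subgraphOfEdges u A).verts → q ∉ S →
      ∃ x y, (G.subgraphOfEdges u A).Adj x y ∧ x ∈ S ∧ y ∉ S := by
    rintro S q hu (rfl | ⟨y, hqy, hyA⟩) hq
    · exact absurd hu hq
    have hqu : q ≠ u := fun h => hq (h ▸ hu)
    by_cases hyu : y = u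
    · exact ⟨u, q, ⟨h.adj_hub hqu, by rwa [Sym2.eq_swap, ← hyu]⟩, hu, hq⟩
    have hpair : s(q, y) = s(a, b) := by
      have := ((h.adj_iff q y).1 hqy).2
      tauto
    have hor : s(u, q) ∈ A ∨ s(u, y) ∈ A := by
      have := hA (hpair ▸ hyA)
      rcases Sym2.eq_iff.1 hpair with ⟨rfl, rfl⟩ | ⟨rfl, rfl⟩
      · exact this
      · exact this.symm
    rcases hor with h1 | h1
    · exact ⟨u, q, ⟨h.adj_hub hqu, h1⟩, hu, hq⟩
    · by_cases hyS : y ∈ S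
      · exact ⟨y, q, ⟨hqy.symm, by rwa [Sym2.eq_swap]⟩, hyS, hq⟩
      · exact ⟨u, y, ⟨h.adj_hub hyu, h1⟩, hu, hyS⟩
  refine Subgraph.connected_of_exists_adj ⟨u, Or.inl rfl⟩ fun S p q hp hpS hq hqS => ?_
  by_cases hu : u ∈ S
  · exact key S q hu hq hqS
  · obtain ⟨x, y, hxy, hx, hy⟩ := key Sᶜ p hu hp (not_not.2 hpS)
    exact ⟨y, x, hxy.symm, not_not.1 hy, hx⟩

/-- Of the `2 ^ n` edge sets, only the `2 ^ (n - 3)` containing `ab` but neither `ua` nor `ub` fail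
to give a connected subgraph through `u`. The last `n` subgraphs avoid `u`: the `n - 1` other
vertices and the edge `ab`. -/
theorem le_coreIndex [Fintype V] (h : G.IsPineapple u a b) :
    7 * 2 ^ (Fintype.card V - 3) + Fintype.card V ≤ coreIndex G := by
  classical
  have hcard := h.isUnicyclic.card_edgeFinset
  have h3 := h.isUnicyclic.three_le_card
  set E := G.edgeFinset with hE
  have hua : s(u, a) ∈ E := SimpleGraph.mem_edgeFinset.2 (h.adj_hub h.ne_left)
  have hub : s(u, b) ∈ E := SimpleGraph.mem_edgeFinset.2 (h.adj_hub h.ne_right)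
  have hab : s(a, b) ∈ E := SimpleGraph.mem_edgeFinset.2 h.adj_pair
  have hne := h.ne
  have hnea := h.ne_left
  have hneb := h.ne_right
  have hne1 : s(u, a) ≠ s(u, b) := fun h => hne (Sym2.congr_right.1 h)
  have hsub : {s(a, b)} ⊆ E \ {s(u, a), s(u, b)} := by
    rw [Finset.singleton_subset_iff, Finset.mem_sdiff]
    refine ⟨hab, ?_⟩
    simp only [Finset.mem_insert, Finset.mem_singleton, Sym2.eq_iff]
    grind
  set B := Finset.Icc {s(a, b)} (E \ {s(u, a), s(u, b)}) with hB
  have hBcard : B.card = 2 ^ (Fintype.card V - 3) := by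
    rw [hB, Finset.card_Icc_finset hsub, Finset.card_sdiff_of_subset (by
      rw [Finset.insert_subset_iff, Finset.singleton_subset_iff]
      exact ⟨hua, hub⟩), Finset.card_pair hne1, Finset.card_singleton, hcard]
    congr 1
  have hBE : B ⊆ E.powerset := fun A hA =>
    Finset.mem_powerset.2 ((Finset.mem_Icc.1 hA).2.trans Finset.sdiff_subset)
  set T₁ : Set G.Subgraph :=
    G.subgraphOfEdges u '' ((E.powerset \ B : Finset (Finset (Sym2 V))) : Set _) with hT₁
  set T₂ : Set G.Subgraph := G.singletonSubgraph '' {u}ᶜ with hT₂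
  have hc₁ : T₁.ncard + 2 ^ (Fintype.card V - 3) = 2 ^ Fintype.card V := by
    rw [hT₁, Set.InjOn.ncard_image
      ((subgraphOfEdges_injOn u).mono (Finset.coe_subset.2 Finset.sdiff_subset)),
      Set.ncard_coe_finset, ← hBcard, Finset.card_sdiff_add_card_eq_card hBE,
      Finset.card_powerset, hcard]
  have hc₂ : T₂.ncard + 1 = Fintype.card V := by
    rw [hT₂, Set.ncard_image_of_injective, Set.ncard_compl, Set.ncard_singleton,
      Nat.card_eq_fintype_card]
    · omega
    · intro x y hxy
      exact Set.singleton_injective (congrArg Subgraph.verts hxy)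
  have hd₁ : Disjoint T₁ (insert (G.subgraphOfAdj h.adj_pair) T₂) := by
    rw [Set.disjoint_left]
    rintro _ ⟨A, -, rfl⟩ (h1 | ⟨x, hx, h1⟩)
    · have hu : u ∈ (G.subgraphOfAdj h.adj_pair).verts := h1 ▸ Or.inl rfl
      rcases hu with hu | hu
      · exact hnea hu.symm
      · exact hneb hu.symm
    · have hu : u ∈ (G.singletonSubgraph x).verts := h1 ▸ Or.inl rfl
      exact hx (Eq.symm hu)
  have hd₂ : G.subgraphOfAdj h.adj_pair ∉ T₂ := by
    rintro ⟨x, -, hx⟩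
    have ha : a ∈ (G.singletonSubgraph x).verts := hx ▸ Or.inl rfl
    have hb : b ∈ (G.singletonSubgraph x).verts := hx ▸ Or.inr rfl
    exact hne (Eq.trans ha (Eq.symm hb))
  have hT : T₁ ∪ insert (G.subgraphOfAdj h.adj_pair) T₂ ⊆ G.connectedSubgraphs := by
    rintro _ (⟨A, hA, rfl⟩ | rfl | ⟨x, -, rfl⟩)
    · rw [Finset.mem_coe, Finset.mem_sdiff, Finset.mem_powerset, hB, Finset.mem_Icc] at hA
      refine h.connected_subgraphOfEdges fun hmem => ?_
      by_contra! hcon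
      refine hA.2 ⟨Finset.singleton_subset_iff.2 hmem, fun e he => ?_⟩
      rw [Finset.mem_sdiff, Finset.mem_insert, Finset.mem_singleton]
      refine ⟨hA.1 he, ?_⟩
      rintro (rfl | rfl)
      · exact hcon.1 he
      · exact hcon.2 he
    · exact Subgraph.subgraphOfAdj_connected _
    · exact Subgraph.singletonSubgraph_connected
  have hle := Set.ncard_le_ncard hT
  rw [Set.ncard_union_eq hd₁, Set.ncard_insert_of_notMem hd₂, ← coreIndex_eq_ncard] at hle
  have hpow : 2 ^ Fintype.card V = 8 * 2 ^ (Fintype.card V - 3) := by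
    rw [show 8 = 2 ^ 3 from rfl, ← pow_add]
    congr 1
    omega
  omega

theorem coreIndex_eq [Fintype V] (h : G.IsPineapple u a b) :
    coreIndex G = 7 * 2 ^ (Fintype.card V - 3) + Fintype.card V :=
  le_antisymm (IsUnicyclic.coreIndex_le _ V G rfl h.isUnicyclic).1 h.le_coreIndex

end IsPineapple

end SimpleGraph

open SimpleGraph in
theorem theorem4p5 (n : ℕ) (hn : 4 ≤ n) :
    IsUnicyclic (pineapple n 3) ∧
    coreIndex (pineapple n 3) = 7 * 2 ^ (n - 3) + n ∧
    ∀ (V : Type*) [Fintype V] (G : SimpleGraph V), Fintype.card V = n → IsUnicyclic G →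
      coreIndex G ≤ coreIndex (pineapple n 3) ∧
      (coreIndex G = coreIndex (pineapple n 3) ↔ Nonempty (G ≃g pineapple n 3)) := by
  have hp := isPineapple_pineapple (n := n) (by omega)
  have hcore : coreIndex (pineapple n 3) = 7 * 2 ^ (n - 3) + n := by
    simpa using hp.coreIndex_eq
  refine ⟨hp.isUnicyclic, hcore, fun V _ G hV hG => ?_⟩
  have hbound := IsUnicyclic.coreIndex_le n V G hV hG
  rw [hcore]
  refine ⟨hbound.1, fun heq => ?_, ?_⟩
  · obtain ⟨r, hr⟩ := hbound.2 hn heq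
    obtain ⟨a, b, hG'⟩ := IsUnicyclic.exists_isPineapple hG hr
    exact hG'.nonempty_iso hp (by rw [hV, Fintype.card_fin])
  · rintro ⟨e⟩
    -- The isomorphism carries the hub `0` back to a vertex of `G` adjacent to all others.
    obtain ⟨a, b, hG'⟩ := IsUnicyclic.exists_isPineapple hG
      (u := e.symm ⟨0, by omega⟩) fun x hx => by
        rw [← e.map_adj_iff, RelIso.apply_symm_apply]
        exact hp.adj_hub fun h => hx (by rw [← h, RelIso.symm_apply_apply])
    rw [hG'.coreIndex_eq, hV]
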